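/- Let $n\in\mathbb{N}$ with $5\le n\le 200$. Call $(r,s,t)\in\mathbb{N}^3$ admissible for $n$ if $4\le r\le s\le t<n$ and $r+s+t=2n$. For every triple $(r,s,t)$ admissible for $n$, the polynomial $$x^n-x^{n-r}-x^{n-s}-x^{n-t}-2$$ has exactly one positive real root. Moreover, if $(r_1,s_1,t_1)\ne(r_2,s_2,t_2)$ are two triples admissible for the same $n$, and $\rho_k$ denotes the only positive real root of $x^n-x^{n-r_k}-x^{n-s_k}-x^{n-t_k}-2$ for $k=1,2$, then $\rho_1\ne\rho_2$. -/

import Mathlib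

open Polynomial

/-- The real polynomial `x^n - x^(n-r) - x^(n-s) - x^(n-t) - 2`, used only for `r, s, t < n`. -/
noncomputable def type5Poly (n r s t : ℕ) : ℝ[X] :=
  X ^ n - X ^ (n - r) - X ^ (n - s) - X ^ (n - t) - C 2

/-- The admissible triples: `4 ≤ r ≤ s ≤ t < n` and `r + s + t = 2n`. -/
def IsType5Triple (n r s t : ℕ) : Prop :=
  4 ≤ r ∧ r ≤ s ∧ s ≤ t ∧ t < n ∧ r + s + t = 2 * n

/-!
Write `a = n - r`, `b = n - s`, `c = n - t`, so that `a ≥ b ≥ c ≥ 1` and `a + b + c = n`. With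
`u = x ^ a`, `v = x ^ b`, `w = x ^ c`, a positive root is a solution of `u v w = u + v + w + 2`.
It is unique by monotonicity, and it exceeds `1`.

Suppose that two different triples `(a, b, c)` and `(a', b', c')` with sum `n` have a common
positive root `ρ`. The two triples of powers of `ρ` then have the same sum and the same product.
This forces `c ≠ c'`, and if `c < c'`, a comparison of the cubics with these roots (`false_of_lt`)
forces `c < c' ≤ b' < b ≤ a < a'`. In this situation the difference of the two polynomials,
divided by `x ^ c`, has constant coefficient `-1`, so `ρ` is an algebraic unit.

The polynomial `F = x ^ n - x ^ a - x ^ b - x ^ c - 2` has no such unit root when `a, b, c` are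
distinct, by an argument in the style of Ljunggren. Let `p` be the minimal polynomial of `ρ` over
the integers, so that `p(0) = ±1`, and write `F = p q`. Reversing `p` gives
`G = p(0) p* q`, with `*` for reversal. It is monic, `G(0) = -2`, `G G* = F F*`, and `G ≠ F` as `ρ⁻¹`
is not a root of `F` (`exists_mul_reverse_eq`). Comparing the sum of the squares of the
coefficients and the value at `1` shows that `G` is again of the form
`x ^ n - x ^ α - x ^ β - x ^ γ - 2` (`exists_eq_gapPoly`). The remaining coefficients of
`G G* = F F*` are the autocorrelations of the coefficient sequences, and comparing them at the
largest relevant distances gives `{α, β, γ} = {a, b, c}` (`eq_of_autocorrelation_eq`), a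
contradiction.

It remains that neither triple has distinct entries, that is `a = b` and `b' = c'`. Then
`F = (x ^ b + 1) (x ^ (b + c) - x ^ c - 2)`, and the same argument applies to the trinomial factor
(`false_of_unit_trinomial`).
-/

/-! ### Reversing a unit factor -/

/-- Reversal is an involution on polynomials with nonzero constant coefficient. -/
lemma reverse_reverse_of_coeff_zero_ne_zero {p : ℤ[X]} (h : p.coeff 0 ≠ 0) :
    p.reverse.reverse = p := by
  have hd : p.reverse.natDegree = p.natDegree := by
    rw [reverse_natDegree, natTrailingDegree_eq_zero.2 (Or.inr h), Nat.sub_zero]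
  have h1 : p.reverse.reverse = reflect p.reverse.natDegree (reflect p.natDegree p) := rfl
  rw [h1, hd, reflect_reflect]

/-- If a root `ρ` of a monic integer polynomial `F` is also a root of an integer polynomial with
constant coefficient `-1`, then the minimal polynomial of `ρ` has constant coefficient `±1`, and
reversing this factor of `F` gives a polynomial `G` with the same product `G * G.reverse`. It
differs from `F` as soon as `ρ⁻¹` is not a root of `F`. -/
lemma exists_mul_reverse_eq {F U : ℤ[X]} (hF : F.Monic) {ρ : ℝ}
    (hρ : ρ ≠ 0) (hroot : aeval ρ F = 0) (hU : aeval ρ U = 0) (hU0 : U.coeff 0 = -1)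
    (hinv : aeval ρ⁻¹ F ≠ 0) :
    ∃ G : ℤ[X], G.Monic ∧ G.natDegree = F.natDegree ∧ G.coeff 0 = F.coeff 0 ∧
      G * G.reverse = F * F.reverse ∧ G ≠ F := by
  have hint : IsIntegral ℤ ρ := ⟨F, hF, by simpa [aeval_def] using hroot⟩
  obtain ⟨q, hq⟩ := minpoly.isIntegrallyClosed_dvd hint hroot
  obtain ⟨u, hu⟩ := minpoly.isIntegrallyClosed_dvd hint hU
  have hpm := minpoly.monic hint
  have hp0 := minpoly.aeval ℤ ρ
  set p := minpoly ℤ ρ with hp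
  clear_value p
  have hcu : p.coeff 0 * u.coeff 0 = -1 := by rw [← mul_coeff_zero, ← hu, hU0]
  have hc : p.coeff 0 * p.coeff 0 = 1 := by
    have hunit : IsUnit (p.coeff 0) := IsUnit.of_mul_eq_one (-u.coeff 0) (by linarith)
    rcases Int.isUnit_iff.1 hunit with h | h <;> simp [h]
  have hcne : p.coeff 0 ≠ 0 := by rintro h; simp [h] at hc
  have hqm : q.Monic := hpm.of_mul_monic_left (hq ▸ hF)
  have htr : p.trailingCoeff = p.coeff 0 := by
    rw [trailingCoeff, natTrailingDegree_eq_zero.2 (Or.inr hcne)]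
  have hrd : p.reverse.natDegree = p.natDegree := by
    rw [reverse_natDegree, natTrailingDegree_eq_zero.2 (Or.inr hcne), Nat.sub_zero]
  have hpr : (C (p.coeff 0) * p.reverse).Monic := by
    rw [Monic, leadingCoeff_mul, leadingCoeff_C, reverse_leadingCoeff, htr, hc]
  -- the factor `p.coeff 0 = ±1` makes the reversed minimal polynomial monic
  refine ⟨C (p.coeff 0) * p.reverse * q, hpr.mul hqm, ?_, ?_, ?_, ?_⟩
  · rw [hpr.natDegree_mul hqm, natDegree_C_mul hcne, hrd, hq, hpm.natDegree_mul hqm]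
  · rw [hq, mul_coeff_zero, mul_coeff_zero, coeff_C_zero, coeff_zero_reverse, hpm.leadingCoeff,
      mul_one, mul_coeff_zero]
  · have hC : (C (p.coeff 0) : ℤ[X]) * C (p.coeff 0) = 1 := by rw [← C_mul, hc, C_1]
    rw [reverse_mul_of_domain, reverse_mul_of_domain, reverse_reverse_of_coeff_zero_ne_zero hcne,
      reverse_C, hq, reverse_mul_of_domain]
    linear_combination (p.reverse * q * p * q.reverse) * hC
  · intro h
    rw [hq] at h
    have h2 : C (p.coeff 0) * p.reverse = p := mul_right_cancel₀ hqm.ne_zero h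
    apply hinv
    let _ : Invertible ρ := invertibleOfNonzero hρ
    have h3 : aeval ρ⁻¹ p.reverse = 0 := by
      have := (eval₂_reverse_eq_zero_iff (algebraMap ℤ ℝ) ρ p).2 hp0
      rwa [invOf_eq_inv] at this
    rw [hq, map_mul, ← h2, map_mul, h3, mul_zero, zero_mul]

/-! ### Autocorrelation of the coefficients -/

/-- The coefficients of `F * F.reverse` from the middle one upwards are the autocorrelations of
the coefficient sequence of `F`. -/
lemma coeff_mul_reverse (F : ℤ[X]) (k : ℕ) :
    (F * F.reverse).coeff (F.natDegree + k) =
      ∑ j ∈ Finset.range (F.natDegree + 1), F.coeff j * F.coeff (j + k) := by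
  rw [mul_comm, coeff_mul, Finset.Nat.sum_antidiagonal_eq_sum_range_succ_mk,
    ← Finset.sum_subset (s₁ := Finset.range (F.natDegree + 1)), ← Finset.sum_range_reflect]
  · refine Finset.sum_congr rfl fun j hj => ?_
    have hj : j ≤ F.natDegree := by simpa [Nat.lt_succ_iff] using hj
    simp only [coeff_reverse]
    rw [revAt_le (by omega)]
    congr 2 <;> omega
  · intro j hj
    simp only [Finset.mem_range] at hj ⊢
    omega
  · intro j _ hj
    have : F.reverse.coeff j = 0 := by
      apply coeff_eq_zero_of_natDegree_lt
      have := reverse_natDegree_le F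
      simp only [Finset.mem_range] at hj
      omega
    simp [this]

/-- The polynomial `X ^ n - ∑ i ∈ A, X ^ i - 2`, used for `A` contained in the open interval
from `0` to `n`. -/
noncomputable def gapPoly (n : ℕ) (A : Finset ℕ) : ℤ[X] :=
  X ^ n - ∑ i ∈ A, X ^ i - C 2

lemma coeff_gapPoly (n : ℕ) (A : Finset ℕ) (j : ℕ) :
    (gapPoly n A).coeff j =
      (if j = n then 1 else 0) - (if j ∈ A then 1 else 0) - (if j = 0 then 2 else 0) := by
  simp only [gapPoly, coeff_sub, finsetSum_coeff, coeff_X_pow, coeff_C, Finset.sum_ite_eq]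

lemma natDegree_gapPoly {n : ℕ} {A : Finset ℕ} (hn : 0 < n) (hA : A ⊆ Finset.Ioo 0 n) :
    (gapPoly n A).natDegree = n := by
  apply natDegree_eq_of_le_of_coeff_ne_zero
  · rw [natDegree_le_iff_coeff_eq_zero]
    intro j hj
    have : j ∉ A := fun h => by have := Finset.mem_Ioo.1 (hA h); omega
    rw [coeff_gapPoly, if_neg (by omega), if_neg this, if_neg (by omega)]
    rfl
  · have : n ∉ A := fun h => by have := Finset.mem_Ioo.1 (hA h); omega
    rw [coeff_gapPoly, if_pos rfl, if_neg this, if_neg (by omega)]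
    norm_num

lemma monic_gapPoly {n : ℕ} {A : Finset ℕ} (hn : 0 < n) (hA : A ⊆ Finset.Ioo 0 n) :
    (gapPoly n A).Monic := by
  have : n ∉ A := fun h => by have := Finset.mem_Ioo.1 (hA h); omega
  rw [Monic, leadingCoeff, natDegree_gapPoly hn hA, coeff_gapPoly, if_pos rfl, if_neg this,
    if_neg (by omega)]
  rfl

/-- Pairing the coefficient sequence of `gapPoly n A` with a function. -/
lemma sum_coeff_gapPoly_mul {n : ℕ} {A : Finset ℕ} (hA : A ⊆ Finset.Ioo 0 n) (h : ℕ → ℤ) :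
    ∑ j ∈ Finset.range (n + 1), (gapPoly n A).coeff j * h j =
      h n - ∑ i ∈ A, h i - 2 * h 0 := by
  have hAr : A ⊆ Finset.range (n + 1) := fun i hi => by
    have := Finset.mem_Ioo.1 (hA hi)
    simp only [Finset.mem_range]
    omega
  simp only [coeff_gapPoly, sub_mul, Finset.sum_sub_distrib, ite_mul, zero_mul, one_mul]
  rw [← Finset.sum_filter (fun j => j ∈ A), Finset.filter_mem_eq_inter,
    Finset.inter_eq_right.2 hAr]
  simp

/-- The autocorrelation at distance `k > 0` of the coefficients of `gapPoly n A`. -/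
lemma autocorrelation_gapPoly {n k : ℕ} {A : Finset ℕ} (hk : 0 < k) (hA : A ⊆ Finset.Ioo 0 n) :
    ∑ j ∈ Finset.range (n + 1), (gapPoly n A).coeff j * (gapPoly n A).coeff (j + k) =
      (∑ i ∈ A, ((if i + k ∈ A then 1 else 0) - (if i + k = n then 1 else 0))) +
        2 * (if k ∈ A then 1 else 0) - 2 * (if k = n then 1 else 0) := by
  have : n + k ∉ A := fun h => by have := Finset.mem_Ioo.1 (hA h); omega
  rw [sum_coeff_gapPoly_mul hA (fun j => (gapPoly n A).coeff (j + k))]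
  simp only [coeff_gapPoly, Finset.sum_sub_distrib, zero_add, if_neg this, Nat.add_eq_zero_iff,
    hk.ne', and_false, if_false, Nat.add_eq_left, Finset.sum_const_zero]
  ring

/-- A monic polynomial with constant coefficient `-2` whose coefficients have the same sum of
squares, and up to sign the same sum, as those of a `gapPoly n A`, is itself some `gapPoly n B`:
the inner coefficients `g` satisfy `∑ (g ^ 2 + g) = 0`, so all of them are `0` or `-1`. -/
lemma exists_eq_gapPoly {n m : ℕ} {G : ℤ[X]} (hn : 0 < n) (hG : G.Monic) (hd : G.natDegree = n)
    (h0 : G.coeff 0 = -2)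
    (hsq : ∑ j ∈ Finset.range (n + 1), G.coeff j * G.coeff j = 5 + m)
    (hsum : (∑ j ∈ Finset.range (n + 1), G.coeff j) ^ 2 = (1 + (m : ℤ)) ^ 2) :
    ∃ B : Finset ℕ, B ⊆ Finset.Ioo 0 n ∧ B.card = m ∧ G = gapPoly n B := by
  have hGn : G.coeff n = 1 := by rw [← hd]; exact hG
  have split : ∀ f : ℕ → ℤ, ∑ j ∈ Finset.range (n + 1), f j =
      ∑ j ∈ Finset.Ioo 0 n, f j + f 0 + f n := by
    intro f
    rw [Finset.sum_range_succ, Finset.range_eq_Ico, ← Finset.Ioo_insert_left hn,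
      Finset.sum_insert (by simp)]
    ring
  rw [split, h0, hGn] at hsq hsum
  -- integers satisfy `g ≤ g ^ 2`; this excludes the value `m + 2` for the sum of the inner
  -- coefficients, the other one being `-m`
  have hle : ∑ j ∈ Finset.Ioo 0 n, G.coeff j ≤ ∑ j ∈ Finset.Ioo 0 n, G.coeff j * G.coeff j :=
    Finset.sum_le_sum fun j _ => Int.le_self_sq _ |>.trans_eq (sq _)
  have hS : ∑ j ∈ Finset.Ioo 0 n, G.coeff j = -m := by
    rcases sq_eq_sq_iff_eq_or_eq_neg.1 hsum with h | h <;> linarith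
  have hzero : ∑ j ∈ Finset.Ioo 0 n, (G.coeff j * G.coeff j + G.coeff j) = 0 := by
    rw [Finset.sum_add_distrib]
    linarith
  have hnn : ∀ g : ℤ, 0 ≤ g * g + g := fun g => by
    have := Int.le_self_sq (-g)
    nlinarith
  have hval : ∀ j ∈ Finset.Ioo 0 n, G.coeff j = 0 ∨ G.coeff j = -1 := by
    intro j hj
    have := (Finset.sum_eq_zero_iff_of_nonneg fun j _ => hnn (G.coeff j)).1 hzero j hj
    have h2 : G.coeff j * (G.coeff j + 1) = 0 := by linarith
    rcases mul_eq_zero.1 h2 with h | h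
    · exact Or.inl h
    · exact Or.inr (by linarith)
  refine ⟨(Finset.Ioo 0 n).filter fun j => G.coeff j = -1, Finset.filter_subset _ _, ?_, ?_⟩
  · have h1 : ∑ j ∈ Finset.Ioo 0 n, G.coeff j =
        ∑ j ∈ Finset.Ioo 0 n, if G.coeff j = -1 then (-1 : ℤ) else 0 :=
      Finset.sum_congr rfl fun j hj => by rcases hval j hj with h | h <;> simp [h]
    rw [hS, ← Finset.sum_filter, Finset.sum_const] at h1
    simpa [eq_comm] using h1
  · ext j
    rw [coeff_gapPoly]
    simp only [Finset.mem_filter, Finset.mem_Ioo]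
    rcases Nat.eq_zero_or_pos j with rfl | hj
    · simp [h0, hn.ne]
    rcases lt_trichotomy j n with h | rfl | h
    · rcases hval j (Finset.mem_Ioo.2 ⟨hj, h⟩) with h' | h' <;> simp [h', hj, hj.ne', h, h.ne]
    · simp [hGn, hj.ne']
    · rw [coeff_eq_zero_of_natDegree_lt (by omega)]
      simp [hj.ne', h.ne']

lemma aeval_gapPoly (n : ℕ) (A : Finset ℕ) (x : ℝ) :
    aeval x (gapPoly n A) = x ^ n - ∑ i ∈ A, x ^ i - 2 := by
  simp only [gapPoly, map_sub, map_pow, aeval_X, map_sum, map_ofNat]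

/-- If a root `ρ > 1` of `gapPoly n A` is an algebraic unit, then some other exponent set `B` of
the same size has the same autocorrelations as `A`. -/
lemma exists_ne_autocorrelation_eq {n : ℕ} {A : Finset ℕ} {U : ℤ[X]} {ρ : ℝ} (hn : 0 < n)
    (hA : A ⊆ Finset.Ioo 0 n) (hρ : 1 < ρ) (hroot : aeval ρ (gapPoly n A) = 0)
    (hU : aeval ρ U = 0) (hU0 : U.coeff 0 = -1) :
    ∃ B : Finset ℕ, B ⊆ Finset.Ioo 0 n ∧ B.card = A.card ∧ B ≠ A ∧ ∀ k, 0 < k →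
      (∑ i ∈ A, ((if i + k ∈ A then 1 else 0) - (if i + k = n then 1 else 0))) +
        2 * (if k ∈ A then 1 else 0) =
      (∑ i ∈ B, ((if i + k ∈ B then 1 else 0) - (if i + k = n then 1 else 0))) +
        2 * (if k ∈ B then (1 : ℤ) else 0) := by
  have hinv : aeval ρ⁻¹ (gapPoly n A) ≠ 0 := by
    have h1 : ρ⁻¹ ^ n < 1 := pow_lt_one₀ (by positivity) (inv_lt_one_of_one_lt₀ hρ) hn.ne'
    have h2 : 0 ≤ ∑ i ∈ A, ρ⁻¹ ^ i := by positivity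
    rw [aeval_gapPoly]
    linarith
  obtain ⟨G, hGm, hGd, hG0, hGG, hne⟩ :=
    exists_mul_reverse_eq (monic_gapPoly hn hA) (by positivity) hroot hU hU0 hinv
  rw [natDegree_gapPoly hn hA] at hGd
  have h0A : 0 ∉ A := fun h => by have := Finset.mem_Ioo.1 (hA h); omega
  have hnA : n ∉ A := fun h => by have := Finset.mem_Ioo.1 (hA h); omega
  have hF0 : (gapPoly n A).coeff 0 = -2 := by
    rw [coeff_gapPoly, if_neg hn.ne, if_neg h0A, if_pos rfl]
    rfl
  have hcor : ∀ k, ∑ j ∈ Finset.range (n + 1), G.coeff j * G.coeff (j + k) =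
      ∑ j ∈ Finset.range (n + 1), (gapPoly n A).coeff j * (gapPoly n A).coeff (j + k) := by
    intro k
    have h1 := coeff_mul_reverse G k
    have h2 := coeff_mul_reverse (gapPoly n A) k
    rw [hGd] at h1
    rw [natDegree_gapPoly hn hA] at h2
    rw [← h1, ← h2, hGG]
  have hsq : ∑ j ∈ Finset.range (n + 1), G.coeff j * G.coeff j = 5 + A.card := by
    have h := hcor 0
    simp only [add_zero] at h
    rw [h, sum_coeff_gapPoly_mul hA (fun j => (gapPoly n A).coeff j)]
    have h3 : ∑ i ∈ A, (gapPoly n A).coeff i = ∑ i ∈ A, (-1 : ℤ) :=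
      Finset.sum_congr rfl fun i hi => by
        have := Finset.mem_Ioo.1 (hA hi)
        rw [coeff_gapPoly, if_neg (by omega), if_pos hi, if_neg (by omega)]
        rfl
    rw [h3, hF0, coeff_gapPoly, if_pos rfl, if_neg hnA, if_neg hn.ne']
    simp
    ring
  have hrev : ∀ p : ℤ[X], p.reverse.eval 1 = p.eval 1 := fun p => by
    let _ : Invertible (1 : ℤ) := invertibleOne
    have := eval₂_reverse_mul_pow (RingHom.id ℤ) 1 p
    simpa [eval₂_id] using this
  have hev : ∀ p : ℤ[X], p.natDegree = n →
      p.eval 1 = ∑ j ∈ Finset.range (n + 1), p.coeff j := fun p hp => by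
    rw [eval_eq_sum_range, hp]
    simp
  have hsum : (∑ j ∈ Finset.range (n + 1), G.coeff j) ^ 2 = (1 + (A.card : ℤ)) ^ 2 := by
    have h := congrArg (eval 1) hGG
    rw [eval_mul, eval_mul, hrev, hrev, hev G hGd] at h
    rw [sq, h]
    simp [gapPoly, eval_finsetSum]
    ring
  obtain ⟨B, hB, hcard, rfl⟩ := exists_eq_gapPoly hn hGm hGd (hG0.trans hF0) hsq hsum
  refine ⟨B, hB, hcard, fun h => hne (h ▸ rfl), fun k hk => ?_⟩
  have h := hcor k
  rw [autocorrelation_gapPoly hk hA, autocorrelation_gapPoly hk hB] at h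
  linarith

/-! ### Exponent sets determined by their autocorrelations -/

/-- The polynomial `X ^ (a + c) - X ^ c - 2` has no algebraic unit as a root greater than `1`:
the autocorrelation at distance `c` determines `c`. -/
lemma false_of_unit_trinomial {a c : ℕ} {U : ℤ[X]} {ρ : ℝ} (ha : 0 < a) (hc : 0 < c)
    (hρ : 1 < ρ) (hroot : ρ ^ (a + c) = ρ ^ c + 2) (hU : aeval ρ U = 0)
    (hU0 : U.coeff 0 = -1) : False := by
  obtain ⟨B, hB, hcard, hne, h⟩ := exists_ne_autocorrelation_eq (n := a + c) (A := {c})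
    (by omega) (by simp [ha, hc]) hρ (by rw [aeval_gapPoly, hroot]; simp) hU hU0
  rw [Finset.card_singleton] at hcard
  obtain ⟨d, rfl⟩ := Finset.card_eq_one.1 hcard
  have hdc : c ≠ d := fun h => hne (by rw [h])
  have h1 := h c hc
  simp only [Finset.sum_singleton, Finset.mem_singleton, Nat.add_eq_left, hc.ne', hdc,
    if_true, if_false] at h1
  split_ifs at h1 <;> omega

/-- The exponents of `X ^ (a + b + c) - X ^ a - X ^ b - X ^ c - 2` are determined by the
autocorrelations of its coefficients. Moving the negative terms to the other side, the positive
distances form two equal multisets: on one side `a, a, b, b, c, c`, the differences of `a, b, c`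
and `n - α, n - β, n - γ`, and on the other side the same with the roles exchanged, where
`n = a + b + c`. The largest distances that remain after cancellation yield `γ = c`, `β = b` and
`α = a` in turn. -/
lemma eq_of_autocorrelation_eq {a b c α β γ : ℕ} (hc : 0 < c) (hcb : c < b) (hba : b < a)
    (hγ : 0 < γ) (hγβ : γ < β) (hβα : β < α) (hα : α < a + b + c)
    (h : ∀ k, 0 < k →
      (∑ i ∈ ({a, b, c} : Finset ℕ), ((if i + k ∈ ({a, b, c} : Finset ℕ) then 1 else 0) -
          (if i + k = a + b + c then 1 else 0))) +
        2 * (if k ∈ ({a, b, c} : Finset ℕ) then 1 else 0) =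
      (∑ i ∈ ({α, β, γ} : Finset ℕ), ((if i + k ∈ ({α, β, γ} : Finset ℕ) then 1 else 0) -
          (if i + k = a + b + c then 1 else 0))) +
        2 * (if k ∈ ({α, β, γ} : Finset ℕ) then (1 : ℤ) else 0)) :
    α = a ∧ β = b ∧ γ = c := by
  have hs : ∀ (x y z : ℕ) (f : ℕ → ℤ), z < y → y < x →
      ∑ i ∈ ({x, y, z} : Finset ℕ), f i = f x + f y + f z := fun x y z f h1 h2 => by
    rw [Finset.sum_insert (by simp; omega), Finset.sum_insert (by simp; omega),
      Finset.sum_singleton, add_assoc]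
  simp only [hs a b c _ hcb hba, hs α β γ _ hγβ hβα, Finset.mem_insert,
    Finset.mem_singleton] at h
  -- a distance `α ≥ a + b` would occur twice on one side, but at most once on the other
  have h1 : α < a + b := by
    by_contra hcon
    have := h α (by omega)
    clear h
    grind (splits := 40)
  -- so the largest distances are `a + b = n - c` and `n - γ`
  have h2 : γ = c := by
    have e1 := h (a + b) (by omega)
    have e2 := h (a + b + c - γ) (by omega)
    clear h
    grind (splits := 40)
  -- with these cancelled, `α ≥ a + c` is excluded in the same way
  have h3 : α < a + c := by
    by_contra hcon
    have := h α (by omega)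
    clear h
    grind (splits := 40)
  -- so the largest distances are now `a + c = n - b` and `n - β`
  have h4 : β = b := by
    have e1 := h (a + c) (by omega)
    have e2 := h (a + b + c - β) (by omega)
    clear h
    grind (splits := 40)
  have h5 : α = a := by
    have e1 := h a (by omega)
    have e2 := h α (by omega)
    clear h
    grind (splits := 40)
  exact ⟨h5, h4, h2⟩

/-- For `a > b > c`, the polynomial `X ^ (a + b + c) - X ^ a - X ^ b - X ^ c - 2` has no algebraic
unit as a root greater than `1`. -/
lemma false_of_unit_pentanomial {a b c : ℕ} {U : ℤ[X]} {ρ : ℝ} (hc : 0 < c) (hcb : c < b)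
    (hba : b < a) (hρ : 1 < ρ) (hroot : ρ ^ (a + b + c) = ρ ^ a + ρ ^ b + ρ ^ c + 2)
    (hU : aeval ρ U = 0) (hU0 : U.coeff 0 = -1) : False := by
  obtain ⟨B, hB, hcard, hne, h⟩ := exists_ne_autocorrelation_eq (n := a + b + c)
    (A := {a, b, c}) (by omega) (by intro i; simp; omega) hρ
    (by
      rw [aeval_gapPoly, hroot, Finset.sum_insert (by simp; omega),
        Finset.sum_insert (by simp; omega), Finset.sum_singleton]
      ring) hU hU0
  have hcard : B.card = 3 := by
    rw [hcard, Finset.card_insert_of_notMem (by simp; omega),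
      Finset.card_insert_of_notMem (by simp; omega), Finset.card_singleton]
  obtain ⟨α, β, γ, hγβ, hβα, rfl⟩ : ∃ α β γ, γ < β ∧ β < α ∧ B = {α, β, γ} := by
    obtain ⟨x, y, z, hxy, hxz, hyz, rfl⟩ := Finset.card_eq_three.1 hcard
    rcases hxy.lt_or_gt with h1 | h1 <;> rcases hxz.lt_or_gt with h2 | h2 <;>
      rcases hyz.lt_or_gt with h3 | h3
    · exact ⟨z, y, x, h1, h3, by ext; simp; tauto⟩
    · exact ⟨y, z, x, h2, h3, by ext; simp; tauto⟩
    · omega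
    · exact ⟨y, x, z, h2, h1, by ext; simp; tauto⟩
    · exact ⟨z, x, y, h1, h2, by ext; simp; tauto⟩
    · omega
    · exact ⟨x, z, y, h3, h2, by ext; simp; tauto⟩
    · exact ⟨x, y, z, h3, h1, rfl⟩
  have hα := Finset.mem_Ioo.1 (hB (show α ∈ ({α, β, γ} : Finset ℕ) by simp))
  have hγ := Finset.mem_Ioo.1 (hB (show γ ∈ ({α, β, γ} : Finset ℕ) by simp))
  obtain ⟨rfl, rfl, rfl⟩ := eq_of_autocorrelation_eq hc hcb hba hγ.1 hγβ hβα hα.2 h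
  exact hne rfl

/-! ### Two exponent triples with a common root -/

/-- If neither of two triples majorizes the other, then a common root of their polynomials is an
algebraic unit, which is impossible. -/
lemma false_of_nested {a b c a' b' c' : ℕ} {ρ : ℝ} (hρ : 1 < ρ) (hc : 0 < c) (hcc : c < c')
    (hcb' : c' ≤ b') (hbb : b' < b) (hba : b ≤ a) (haa : a < a')
    (hsum : a + b + c = a' + b' + c')
    (h : ρ ^ (a + b + c) = ρ ^ a + ρ ^ b + ρ ^ c + 2)
    (h' : ρ ^ (a' + b' + c') = ρ ^ a' + ρ ^ b' + ρ ^ c' + 2) : False := by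
  -- the difference of the two polynomials, divided by `X ^ c`
  let U : ℤ[X] := X ^ (a' - c) + X ^ (b' - c) + X ^ (c' - c) - X ^ (a - c) - X ^ (b - c) - 1
  have hU0 : U.coeff 0 = -1 := by
    have e : ∀ m : ℕ, c < m → (X ^ (m - c) : ℤ[X]).coeff 0 = 0 := fun m hm => by
      rw [coeff_X_pow, if_neg (by omega)]
    simp only [U, coeff_sub, coeff_add, e a' (by omega), e b' (by omega), e c' (by omega),
      e a (by omega), e b (by omega), coeff_one_zero]
    norm_num
  have hU : aeval ρ U = 0 := by
    have e : ∀ m : ℕ, c < m → ρ ^ m = ρ ^ (m - c) * ρ ^ c := fun m hm => by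
      rw [← pow_add, Nat.sub_add_cancel hm.le]
    have h2 : ρ ^ a' + ρ ^ b' + ρ ^ c' - ρ ^ a - ρ ^ b - ρ ^ c = 0 := by
      rw [hsum] at h
      linarith
    rw [e a' (by omega), e b' (by omega), e c' (by omega), e a (by omega), e b (by omega)] at h2
    have h3 : (ρ ^ (a' - c) + ρ ^ (b' - c) + ρ ^ (c' - c) - ρ ^ (a - c) - ρ ^ (b - c) - 1) *
        ρ ^ c = 0 := by linarith
    simpa [U] using (mul_eq_zero.1 h3).resolve_right (by positivity)
  rcases hba.lt_or_eq with hlt | rfl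
  · exact false_of_unit_pentanomial hc (by omega) hlt hρ h hU hU0
  rcases hcb'.lt_or_eq with hlt | rfl
  · exact false_of_unit_pentanomial (by omega) hlt (by omega) hρ h' hU hU0
  -- when `v = ρ ^ b` occurs twice, `v ^ 2 * w = 2 * v + w + 2` factors
  refine false_of_unit_trinomial (a := b) (c := c) (by omega) hc hρ ?_ hU hU0
  rw [pow_add, pow_add] at h
  have hv : ρ ^ b + 1 ≠ 0 := by positivity
  refine mul_left_cancel₀ hv ?_
  rw [pow_add]
  linarith

/-- For triples with `c < c'`, the case `a' ≤ a` is excluded by comparing the cubics with roots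
`ρ ^ a, ρ ^ b, ρ ^ c` and `ρ ^ a', ρ ^ b', ρ ^ c'`: they differ by a multiple of the
variable, and the values at `ρ ^ c` and at `ρ ^ a` force opposite signs. -/
lemma false_of_lt {a b c a' b' c' : ℕ} {ρ : ℝ} (hρ : 1 < ρ) (hc : 0 < c) (hcc : c < c')
    (hba : b ≤ a) (hcb' : c' ≤ b') (hba' : b' ≤ a')
    (hsum : a + b + c = a' + b' + c')
    (h : ρ ^ (a + b + c) = ρ ^ a + ρ ^ b + ρ ^ c + 2)
    (h' : ρ ^ (a' + b' + c') = ρ ^ a' + ρ ^ b' + ρ ^ c' + 2) : False := by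
  rcases lt_or_ge a a' with haa | haa
  · exact false_of_nested hρ hc hcc hcb' (by omega) hba haa hsum h h'
  have hs : ρ ^ a + ρ ^ b + ρ ^ c = ρ ^ a' + ρ ^ b' + ρ ^ c' := by
    rw [hsum] at h
    linarith
  have hp : ρ ^ a * ρ ^ b * ρ ^ c = ρ ^ a' * ρ ^ b' * ρ ^ c' := by
    simp only [← pow_add, hsum]
  have h1 : ρ ^ c < ρ ^ c' := pow_lt_pow_right₀ hρ hcc
  have h2 : ρ ^ c' ≤ ρ ^ b' := pow_le_pow_right₀ hρ.le hcb'
  have h3 : ρ ^ b' ≤ ρ ^ a' := pow_le_pow_right₀ hρ.le hba'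
  have h4 : ρ ^ a' ≤ ρ ^ a := pow_le_pow_right₀ hρ.le haa
  have hw : 0 < ρ ^ c := by positivity
  have hu : 0 < ρ ^ a := by positivity
  generalize ρ ^ a = u at *
  generalize ρ ^ b = v at *
  generalize ρ ^ c = w at *
  generalize ρ ^ a' = u' at *
  generalize ρ ^ b' = v' at *
  generalize ρ ^ c' = w' at *
  have key : ∀ t, (t - u) * (t - v) * (t - w) - (t - u') * (t - v') * (t - w') =
      (u * v + u * w + v * w - u' * v' - u' * w' - v' * w') * t := fun t => by
    linear_combination (-t ^ 2) * hs - hp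
  have k1 : 0 < u * v + u * w + v * w - u' * v' - u' * w' - v' * w' := by
    have e := key w
    have : 0 < (u' - w) * (v' - w) * (w' - w) :=
      mul_pos (mul_pos (by linarith) (by linarith)) (by linarith)
    exact pos_of_mul_pos_left (by linarith) hw.le
  have e := key u
  have : 0 ≤ (u - u') * (u - v') * (u - w') :=
    mul_nonneg (mul_nonneg (by linarith) (by linarith)) (by linarith)
  have := mul_pos k1 hu
  linarith

/-- The case `c = c'` is left: then `ρ ^ a, ρ ^ b` and `ρ ^ a', ρ ^ b'` have the same sum and
the same product. -/
lemma eq_of_common_root {a b c a' b' c' : ℕ} {ρ : ℝ} (hρ : 1 < ρ) (hc : 0 < c) (hc' : 0 < c')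
    (hcb : c ≤ b) (hba : b ≤ a) (hcb' : c' ≤ b') (hba' : b' ≤ a')
    (hsum : a + b + c = a' + b' + c')
    (h : ρ ^ (a + b + c) = ρ ^ a + ρ ^ b + ρ ^ c + 2)
    (h' : ρ ^ (a' + b' + c') = ρ ^ a' + ρ ^ b' + ρ ^ c' + 2) :
    a = a' ∧ b = b' ∧ c = c' := by
  rcases lt_trichotomy c c' with hcc | rfl | hcc
  · exact (false_of_lt hρ hc hcc hba hcb' hba' hsum h h').elim
  · have hs : ρ ^ a + ρ ^ b = ρ ^ a' + ρ ^ b' := by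
      rw [hsum] at h
      linarith
    have hp : ρ ^ a * ρ ^ b = ρ ^ a' * ρ ^ b' := by
      rw [← pow_add, ← pow_add, show a + b = a' + b' by omega]
    have hz : (ρ ^ a - ρ ^ a') * (ρ ^ a - ρ ^ b') = 0 := by
      linear_combination ρ ^ a * hs - hp
    have hinj := pow_right_injective₀ (by linarith : 0 < ρ) hρ.ne'
    rcases mul_eq_zero.1 hz with hz | hz
    · have : a = a' := hinj (sub_eq_zero.1 hz)
      omega
    · have : a = b' := hinj (sub_eq_zero.1 hz)
      omega
  · exact (false_of_lt hρ hc' hcc hba' hcb hba hsum.symm h' h).elim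

/-! ### The positive root -/

lemma isRoot_type5Poly_iff {n r s t : ℕ} {x : ℝ} :
    (type5Poly n r s t).IsRoot x ↔ x ^ n = x ^ (n - r) + x ^ (n - s) + x ^ (n - t) + 2 := by
  simp only [type5Poly, IsRoot.def, eval_sub, eval_pow, eval_X, eval_C]
  constructor <;> intro h <;> linarith

lemma one_lt_of_pow_eq {n a b c : ℕ} {x : ℝ} (hx : 0 < x)
    (h : x ^ n = x ^ a + x ^ b + x ^ c + 2) : 1 < x := by
  by_contra hle
  have h1 : x ^ n ≤ 1 := pow_le_one₀ hx.le (not_lt.1 hle)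
  have : 0 < x ^ a + x ^ b + x ^ c := by positivity
  linarith

/-- Uniqueness holds since `(x ^ a + x ^ b + x ^ c + 2) / x ^ n` is strictly decreasing. -/
lemma existsUnique_pow_eq {n a b c : ℕ} (ha : a < n) (hb : b < n) (hc : c < n) :
    ∃! x : ℝ, 0 < x ∧ x ^ n = x ^ a + x ^ b + x ^ c + 2 := by
  have mono : ∀ x y : ℝ, 0 < x → x < y → x ^ n = x ^ a + x ^ b + x ^ c + 2 →
      y ^ n = y ^ a + y ^ b + y ^ c + 2 → False := by
    intro x y hx hxy h1 h2
    have hy : 0 < y := hx.trans hxy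
    have e : ∀ m, m < n → x ^ n * y ^ m < y ^ n * x ^ m := by
      intro m hm
      have h3 : x ^ (n - m) < y ^ (n - m) := pow_lt_pow_left₀ hxy hx.le (by omega)
      have h4 : ∀ z : ℝ, z ^ n = z ^ (n - m) * z ^ m := fun z => by
        rw [← pow_add, Nat.sub_add_cancel hm.le]
      rw [h4 x, h4 y]
      have : 0 < x ^ m * y ^ m := by positivity
      nlinarith
    have e0 := e 0 (by omega)
    have ea := e a ha
    have eb := e b hb
    have ec := e c hc
    have h5 : x ^ n * (y ^ a + y ^ b + y ^ c + 2) = y ^ n * (x ^ a + x ^ b + x ^ c + 2) := by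
      rw [← h1, ← h2, mul_comm]
    simp only [pow_zero] at e0
    linarith
  obtain ⟨x, hx, hfx⟩ : ∃ x ∈ Set.Icc (1 : ℝ) 5,
      x ^ n - (x ^ a + x ^ b + x ^ c + 2) = 0 := by
    -- at `5` the leading term outweighs four terms of at most `5 ^ (n - 1)` each, one of them
    -- doubled
    refine intermediate_value_Icc (f := fun x : ℝ => x ^ n - (x ^ a + x ^ b + x ^ c + 2))
      (by norm_num) (by fun_prop) ⟨by norm_num, ?_⟩
    obtain ⟨k, rfl⟩ : ∃ k, n = k + 1 := ⟨n - 1, by omega⟩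
    have e : ∀ m, m < k + 1 → (5 : ℝ) ^ m ≤ 5 ^ k := fun m hm =>
      pow_le_pow_right₀ (by norm_num) (by omega)
    have ea := e a ha
    have eb := e b hb
    have ec := e c hc
    have e0 := e 0 (by omega)
    simp only [pow_succ, pow_zero] at e0 ⊢
    linarith
  have hx0 : 0 < x := by linarith [hx.1]
  refine ⟨x, ⟨hx0, by linarith⟩, fun y hy => ?_⟩
  rcases lt_trichotomy y x with hlt | heq | hlt
  · exact (mono y x hy.1 hlt hy.2 (by linarith)).elim
  · exact heq
  · exact (mono x y hx0 hlt (by linarith) hy.2).elim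

theorem mainTheorem9 (n : ℕ) (hn5 : 5 ≤ n) (hn200 : n ≤ 200) :
    (∀ r s t : ℕ, IsType5Triple n r s t →
      ∃! ρ : ℝ, 0 < ρ ∧ (type5Poly n r s t).IsRoot ρ) ∧
    (∀ r₁ s₁ t₁ r₂ s₂ t₂ : ℕ,
      IsType5Triple n r₁ s₁ t₁ → IsType5Triple n r₂ s₂ t₂ →
      (r₁, s₁, t₁) ≠ (r₂, s₂, t₂) →
      ∀ ρ₁ ρ₂ : ℝ,
        0 < ρ₁ → (type5Poly n r₁ s₁ t₁).IsRoot ρ₁ →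
        0 < ρ₂ → (type5Poly n r₂ s₂ t₂).IsRoot ρ₂ →
        ρ₁ ≠ ρ₂) := by
  simp only [isRoot_type5Poly_iff]
  refine ⟨fun r s t ⟨h1, h2, h3, h4, h5⟩ =>
    existsUnique_pow_eq (by omega) (by omega) (by omega), ?_⟩
  rintro r₁ s₁ t₁ r₂ s₂ t₂ ⟨h1, h2, h3, h4, h5⟩ ⟨h1', h2', h3', h4', h5'⟩ hne ρ _ hρ h _ h' rfl
  have e : n - r₁ + (n - s₁) + (n - t₁) = n := by omega
  have e' : n - r₂ + (n - s₂) + (n - t₂) = n := by omega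
  obtain ⟨ha, hb, hc⟩ := eq_of_common_root (one_lt_of_pow_eq hρ h)
    (a := n - r₁) (b := n - s₁) (c := n - t₁) (a' := n - r₂) (b' := n - s₂) (c' := n - t₂)
    (by omega) (by omega) (by omega) (by omega) (by omega) (by omega) (e.trans e'.symm)
    (by rw [e]; exact h) (by rw [e']; exact h')
  exact hne (by rw [show r₁ = r₂ by omega, show s₁ = s₂ by omega, show t₁ = t₂ by omega])
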